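/- Let $\mathcal N\subset\mathbb N$, let $X$ be a separable real Hilbert space with orthonormal (Hilbert) basis $(e_k)_{k\in\mathcal N}$, write $x_k=\langle x,e_k\rangle$, and let $Y$ be a separable real Hilbert space. For every $k\in\mathcal N$ let $I_k\subset\mathbb R$ be a bounded closed interval, and suppose that there is $\omega>0$, independent of $k$, with $[-\omega,\omega]\subset I_k$ for all $k\in\mathcal N$. Write $\sigma_{I}(t)=\sup_{s\in I}st$ for the support function of $I$, and $$\|x\|_{1,\mathcal I}=\sum_{k\in\mathcal N}\sigma_{I_k}(x_k)\in[0,+\infty].$$ Let $A\colon X\to Y$ be a bounded linear operator, $y\in Y$, $h(x)=\tfrac12\|Ax-y\|_Y^2$, and $$f\colon X\to[0,+\infty],\qquad f(x)=\|x\|_{1,\mathcal I}+\tfrac12\|Ax-y\|_Y^2 .$$ Let $L\in\,]0,+\infty[$ be a Lipschitz constant of $\nabla h$, let $\lambda\in\,]0,2L^{-1}[$ and $x^0\in X$, and let $(x^n)_{n\in\mathbb N}$ be generated by the forward-backward algorithm (iterative soft thresholding) $$x^{n+1}=\operatorname{prox}_{\lambda\|\cdot\|_{1,\mathcal I}}\bigl(x^n-\lambda\nabla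 h(x^n)\bigr),\qquad \operatorname{prox}_{\lambda g}(w)=\operatorname*{argmin}_{z\in X}\Bigl\{g(z)+\tfrac1{2\lambda}\|z-w\|^2\Bigr\}.$$ Then $(x^n)_{n\in\mathbb N}$ converges strongly to some $\bar x\in\operatorname{argmin} f$, and there exist two constants $\varepsilon\in\,]0,1[$ and $C\in\,]0,+\infty[$, depending on $(\lambda,L,x^0,\mathcal I,A,y)$, such that $$(\forall n\ge1)\qquad f(x^n)-\inf f\le\varepsilon^n\,(f(x^0)-\inf f)\quad\text{and}\quad\|x^{n+1}-\bar x\|\le C\sqrt{\varepsilon}^{\,n}.$$ (If $f(x^0)=+\infty$, the right-hand side of the first inequality is $+\infty$.) -/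

import Mathlib

noncomputable section

namespace ISTA

open Set Filter Topology

/-- The support function `σ_C(t) = sup_{s ∈ C} s t` of a set `C ⊆ ℝ`, with values in `[-∞, +∞]`. -/
def supportFun (C : Set ℝ) (t : ℝ) : EReal :=
  ⨆ s ∈ C, ((s * t : ℝ) : EReal)

variable {X : Type*} [NormedAddCommGroup X] [InnerProductSpace ℝ X]
variable {Y : Type*} [NormedAddCommGroup Y] [InnerProductSpace ℝ Y]

/-- The weighted `ℓ¹` norm `‖x‖_{1,𝓘} = ∑_k σ_{I_k}(⟨x, e_k⟩)`, which may be `+∞`.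
When `0 ∈ I k` for all `k` the terms are nonnegative, and the sum converges in `[0, +∞]`. -/
def weightedL1 {N : Set ℕ} (e : HilbertBasis N ℝ X) (I : N → Set ℝ) (x : X) : EReal :=
  ∑' k : N, supportFun (I k) (inner ℝ x (e k))

/-- The least squares term `h(x) = ½ ‖A x - y‖²`. -/
def leastSquares (A : X →L[ℝ] Y) (y : Y) (x : X) : ℝ :=
  1 / 2 * ‖A x - y‖ ^ 2

/-- The objective `f(x) = ‖x‖_{1,𝓘} + ½ ‖A x - y‖²`. -/
def objective {N : Set ℕ} (e : HilbertBasis N ℝ X) (I : N → Set ℝ)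
    (A : X →L[ℝ] Y) (y : Y) (x : X) : EReal :=
  weightedL1 e I x + (leastSquares A y x : EReal)

/-- `p` is a (global) minimizer of `φ`. -/
def IsMinimizer (φ : X → EReal) (p : X) : Prop :=
  IsMinOn φ univ p

/-- The proximity operator: `prox_{l φ}(x)` is the minimizer of
`z ↦ φ(z) + ‖z - x‖² / (2 l)` (unique when `φ` is proper, convex and lower semicontinuous). -/
def prox (φ : X → EReal) (l : ℝ) (x : X) : X :=
  Classical.epsilon fun p : X =>
    IsMinimizer (fun z : X => φ z + ((1 / (2 * l) * ‖z - x‖ ^ 2 : ℝ) : EReal)) p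

/-- The forward-backward iterates for `g + h` with step `l`, started at `x₀`:
`x^{n+1} = prox_{l g}(x^n - l ∇h(x^n))`. -/
def forwardBackward [CompleteSpace X] (g : X → EReal) (h : X → ℝ) (l : ℝ) (x₀ : X) : ℕ → X
  | 0 => x₀
  | n + 1 => prox g l
      (forwardBackward g h l x₀ n - l • gradient h (forwardBackward g h l x₀ n))

end ISTA

end

/-!
The argument is a descent method combined with a quadratic growth property of the objective.

Write `σ_k` for the support function of `I_k = [a k, b k]`. By weak compactness the objective has a
minimizer `p` (`exists_isMinimizer_objective`), and the residual `u = A* (y - A p)` is a subgradient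
of the weighted `ℓ¹` norm at `p` (`realL1_subgradient`). Hence `u_k ∈ I_k` and
`σ_k(p_k) = u_k p_k` for every `k`, and the gap to the minimum is
`f x - f p = ∑ (σ_k(x_k) - u_k x_k) + ‖A (x - p)‖ ^ 2 / 2` (`realObjective_sub_eq`).
The minimizers are therefore the points `z` with `A z = A p` and no excess `σ_k(z_k) - u_k z_k`.

The essential point is that the gap controls the squared distance to the set of minimizers
(`exists_quadratic_growth`). Since `u` is square summable and all intervals contain `[-ω, ω]`, the
inequality `|u_k| < ω / 2` holds off a finite set `J`, and there the excess is at least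
`ω / 2 * |x_k|`. Setting the coordinates that carry excess to zero thus moves `x` by at most a
multiple of the total excess and leaves a vector supported in `J`. What remains is a finite
dimensional polyhedral problem: the clipped vector has to be moved towards `p`, coordinate by
coordinate without overshooting, to a point with image `A p`, at a cost bounded by the
discrepancy of the images. That is the error bound of Hoffman type `exists_conformal_preimage`.

The proximity operator is itself a minimization of the same form, with a multiple of the identity in
place of `A`, so existence and optimality for it come from the same lemmas
(`prox_weightedL1_spec`). The resulting inequality `forwardBackward_step_le`, used with the previous
iterate, says that the gap decreases by a multiple of the squared step length; used with a nearby
minimizer, together with quadratic growth, it bounds the new gap by a multiple of the squared step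
length. Together these contract the gap by a fixed factor (`gap_contraction`), so the steps
decrease geometrically, the iterates converge, and the limit is a minimizer because the set of
minimizers is closed.
-/

noncomputable section

namespace ISTA

open Set Filter Topology

/-! ### A conformal error bound for linear maps -/

/-- An error bound of Hoffman type: for a linear map `B` on `ℝ^ι`, every `d` can be shrunk
coordinatewise, without changes of sign, to some `d'` with the same image whose norm is bounded by
a fixed multiple of that of the image. -/
theorem exists_conformal_preimage {ι Y : Type*} [Fintype ι] [NormedAddCommGroup Y]
    [NormedSpace ℝ Y] (B : (ι → ℝ) →L[ℝ] Y) :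
    ∃ κ, 0 ≤ κ ∧ ∀ d : ι → ℝ, ∃ d' : ι → ℝ,
      (∀ k, ∃ θ, 0 ≤ θ ∧ θ ≤ 1 ∧ d' k = θ * d k) ∧ B d' = B d ∧ ‖d'‖ ≤ κ * ‖B d‖ := by
  -- `D d d'`: the vector `d'` shrinks `d` coordinatewise and has the same image.
  let D : (ι → ℝ) → (ι → ℝ) → Prop := fun d d' =>
    (∀ k, ∃ θ, 0 ≤ θ ∧ θ ≤ 1 ∧ d' k = θ * d k) ∧ B d' = B d
  -- Each `d` has such a vector of minimal `ℓ¹` norm. If no constant worked, normalized minimal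
  -- vectors would accumulate at a kernel vector `v`, and subtracting a multiple of `v` from one of
  -- them would decrease its `ℓ¹` norm.
  have hmin : ∀ d, ∃ d', D d d' ∧ ∀ d'', D d d'' → ∑ k, |d' k| ≤ ∑ k, |d'' k| := by
    intro d
    let K : Set (ι → ℝ) := Icc 0 1 ∩ {θ | B (θ * d) = B d}
    have hK : IsCompact K :=
      (isCompact_Icc (a := (0 : ι → ℝ)) (b := 1)).inter_right
        (isClosed_eq (by fun_prop) continuous_const)
    have hne : K.Nonempty := ⟨1, ⟨zero_le_one, le_rfl⟩, by simp⟩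
    obtain ⟨θ, ⟨hθ, hθB⟩, hθmin⟩ := hK.exists_isMinOn hne
      (f := fun θ => ∑ k, |(θ * d) k|) (by fun_prop)
    refine ⟨θ * d, ⟨fun k => ⟨θ k, hθ.1 k, hθ.2 k, rfl⟩, hθB⟩, ?_⟩
    rintro d'' ⟨hs, hB⟩
    choose η h0 h1 h2 using hs
    have hd : d'' = η * d := funext h2
    rw [hd]
    exact hθmin (a := η) ⟨⟨h0, h1⟩, by rw [mem_ofPred_eq, ← hd, hB]⟩
  by_contra! hcon
  have hseq : ∀ n : ℕ, ∃ d : ι → ℝ, (∀ d', D d d' → (n : ℝ) * ‖B d‖ < ‖d'‖) ∧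
      ∀ d', D d d' → ∑ k, |d k| ≤ ∑ k, |d' k| := by
    intro n
    obtain ⟨d, hd⟩ := hcon n n.cast_nonneg
    obtain ⟨p, hp, hpmin⟩ := hmin d
    have htrans : ∀ d', D p d' → D d d' := by
      rintro d' ⟨hs, hB⟩
      refine ⟨fun k => ?_, hB.trans hp.2⟩
      obtain ⟨θ, h0, h1, h2⟩ := hs k
      obtain ⟨η, g0, g1, g2⟩ := hp.1 k
      exact ⟨θ * η, mul_nonneg h0 g0, mul_le_one₀ h1 g0 g1, by rw [h2, g2, mul_assoc]⟩
    refine ⟨p, fun d' hd' => ?_, fun d' hd' => hpmin d' (htrans d' hd')⟩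
    rw [hp.2]
    exact hd d' (htrans d' hd').1 (htrans d' hd').2
  choose d hd hdmin using hseq
  have hself : ∀ n, D (d n) (d n) := fun n => ⟨fun k => ⟨1, by simp⟩, rfl⟩
  have hpos : ∀ n, 0 < ‖d n‖ := fun n =>
    (mul_nonneg n.cast_nonneg (norm_nonneg _)).trans_lt (hd n _ (hself n))
  obtain ⟨v, hv, φ, hφ, hlim⟩ := (isCompact_sphere (0 : ι → ℝ) 1).tendsto_subseq
    (x := fun n => ‖d n‖⁻¹ • d n) (fun n => by
      rw [mem_sphere_zero_iff_norm, norm_smul, norm_inv, norm_norm,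
        inv_mul_cancel₀ (hpos n).ne'])
  have hBv : B v = 0 := by
    have h1 : Tendsto (fun n => B (‖d (φ n)‖⁻¹ • d (φ n))) atTop (𝓝 (B v)) :=
      (B.continuous.tendsto v).comp hlim
    refine tendsto_nhds_unique h1 (squeeze_zero_norm' ?_
      (tendsto_inv_atTop_nhds_zero_nat.comp hφ.tendsto_atTop))
    filter_upwards [hφ.tendsto_atTop.eventually_gt_atTop 0] with n hn
    have hn' : (0 : ℝ) < φ n := by exact_mod_cast hn
    have := (hd (φ n) _ (hself _)).le
    rw [map_smul, norm_smul, norm_inv, norm_norm, Function.comp, inv_mul_le_iff₀ (hpos _),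
      le_mul_inv_iff₀ hn']
    linarith
  -- Far along the subsequence, `v / 2` is conformal to the normalized vectors.
  have hev : ∀ᶠ n in atTop, ∀ k, v k ≠ 0 → |(‖d (φ n)‖⁻¹ • d (φ n)) k - v k| < |v k| / 2 := by
    rw [eventually_all]
    intro k
    by_cases hk : v k = 0
    · simp [hk]
    have h1 := ((continuous_apply k).tendsto v).comp hlim
    filter_upwards [Metric.tendsto_nhds.1 h1 (|v k| / 2) (by positivity)] with n hn _
    exact hn
  obtain ⟨n, hn⟩ := hev.exists
  set r := ‖d (φ n)‖ with hr
  have hr0 : 0 < r := hpos _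
  have hkey : ∀ k, ∃ θ, 0 ≤ θ ∧ θ ≤ 1 ∧ (d (φ n) - (r / 2) • v) k = θ * d (φ n) k ∧
      (v k ≠ 0 → θ * |d (φ n) k| < |d (φ n) k|) := by
    intro k
    by_cases hk : v k = 0
    · exact ⟨1, zero_le_one, le_rfl, by simp [hk], fun h => absurd hk h⟩
    have h := hn k hk
    set t := (r⁻¹ • d (φ n)) k with ht
    have hdt : d (φ n) k = r * t := by
      rw [ht, Pi.smul_apply, smul_eq_mul, mul_inv_cancel_left₀ hr0.ne']
    have hq : 0 < v k / 2 / t ∧ v k / 2 / t ≤ 1 ∧ t ≠ 0 := by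
      rcases lt_or_gt_of_ne hk with hv0 | hv0
      · rw [abs_of_neg hv0, abs_lt] at h
        have ht0 : t < 0 := by linarith
        exact ⟨div_pos_of_neg_of_neg (by linarith) ht0,
          (div_le_one_of_neg ht0).2 (by linarith), ht0.ne⟩
      · rw [abs_of_pos hv0, abs_lt] at h
        have ht0 : 0 < t := by linarith
        exact ⟨by positivity, (div_le_one ht0).2 (by linarith), ht0.ne'⟩
    refine ⟨1 - v k / 2 / t, by linarith, by linarith, ?_, fun _ => ?_⟩
    · rw [hdt, Pi.sub_apply, hdt, Pi.smul_apply, smul_eq_mul]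
      have := hq.2.2
      field_simp
    · have : 0 < |d (φ n) k| := abs_pos.2 (by rw [hdt]; exact mul_ne_zero hr0.ne' hq.2.2)
      nlinarith
  choose θ h0 h1 h2 h3 using hkey
  have hD : D (d (φ n)) (d (φ n) - (r / 2) • v) :=
    ⟨fun k => ⟨θ k, h0 k, h1 k, h2 k⟩, by rw [map_sub, map_smul, hBv, smul_zero, sub_zero]⟩
  refine absurd (hdmin _ _ hD) (not_le.2 ?_)
  have habs : ∀ k, |(d (φ n) - (r / 2) • v) k| = θ k * |d (φ n) k| := fun k => by
    rw [h2, abs_mul, abs_of_nonneg (h0 k)]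
  simp only [habs]
  have hvne : ∃ k, v k ≠ 0 := by
    by_contra! hz
    have : v = 0 := funext hz
    rw [this] at hv
    simp at hv
  obtain ⟨k, hk⟩ := hvne
  exact Finset.sum_lt_sum (fun i _ => mul_le_of_le_one_left (abs_nonneg _) (h1 i))
    ⟨k, Finset.mem_univ k, h3 k hk⟩

/-! ### Support functions of compact intervals -/

/-- The support function `σ(t) = max (a t) (b t)` of a nonempty interval `[a, b]`, as a real
function. -/
def intervalSupport (a b t : ℝ) : ℝ := max (a * t) (b * t)

theorem supportFun_Icc {a b : ℝ} (hab : a ≤ b) (t : ℝ) :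
    supportFun (Icc a b) t = (intervalSupport a b t : EReal) := by
  refine le_antisymm (iSup₂_le fun s hs => ?_) ?_
  · rw [EReal.coe_le_coe_iff, intervalSupport]
    rcases le_total 0 t with ht | ht
    · exact le_max_of_le_right (mul_le_mul_of_nonneg_right hs.2 ht)
    · exact le_max_of_le_left (mul_le_mul_of_nonpos_right hs.1 ht)
  · rcases max_choice (a * t) (b * t) with h | h
    · rw [intervalSupport, h]
      exact le_iSup₂ (f := fun s (_ : s ∈ Icc a b) => ((s * t : ℝ) : EReal)) a ⟨le_rfl, hab⟩
    · rw [intervalSupport, h]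
      exact le_iSup₂ (f := fun s (_ : s ∈ Icc a b) => ((s * t : ℝ) : EReal)) b ⟨hab, le_rfl⟩

@[fun_prop]
theorem continuous_intervalSupport (a b : ℝ) : Continuous (intervalSupport a b) := by
  unfold intervalSupport; fun_prop

@[simp]
theorem intervalSupport_zero (a b : ℝ) : intervalSupport a b 0 = 0 := by simp [intervalSupport]

theorem mul_le_intervalSupport {a b u : ℝ} (ha : a ≤ u) (hb : u ≤ b) (t : ℝ) :
    u * t ≤ intervalSupport a b t := by
  rcases le_total 0 t with ht | ht
  · exact le_max_of_le_right (mul_le_mul_of_nonneg_right hb ht)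
  · exact le_max_of_le_left (mul_le_mul_of_nonpos_right ha ht)

theorem abs_le_intervalSupport {a b ω : ℝ} (ha : a ≤ -ω) (hb : ω ≤ b) (t : ℝ) :
    ω * |t| ≤ intervalSupport a b t := by
  rcases le_total 0 t with ht | ht
  · rw [abs_of_nonneg ht]
    exact le_max_of_le_right (mul_le_mul_of_nonneg_right hb ht)
  · rw [abs_of_nonpos ht]
    exact le_max_of_le_left (by nlinarith)

theorem intervalSupport_add_le (a b s t : ℝ) :
    intervalSupport a b (s + t) ≤ intervalSupport a b s + intervalSupport a b t := by
  unfold intervalSupport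
  rw [mul_add, mul_add]
  exact max_add_add_le_max_add_max

theorem intervalSupport_mul (a b t : ℝ) {c : ℝ} (hc : 0 ≤ c) :
    intervalSupport a b (c * t) = c * intervalSupport a b t := by
  unfold intervalSupport
  rw [mul_max_of_nonneg _ _ hc]
  ring_nf

/-- The excess `σ(t) - u t` over a linear minorant vanishes between two of its zeros. -/
theorem intervalSupport_eq_mul_of_mem_segment {a b u s t θ : ℝ} (ha : a ≤ u) (hb : u ≤ b)
    (hs : intervalSupport a b s = u * s) (ht : intervalSupport a b t = u * t)
    (hθ₀ : 0 ≤ θ) (hθ₁ : θ ≤ 1) :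
    intervalSupport a b (s + θ * (t - s)) = u * (s + θ * (t - s)) := by
  refine le_antisymm ?_ (mul_le_intervalSupport ha hb _)
  have h := intervalSupport_add_le a b ((1 - θ) * s) (θ * t)
  rw [intervalSupport_mul _ _ _ hθ₀, intervalSupport_mul _ _ _ (by linarith), hs, ht] at h
  have : (1 - θ) * s + θ * t = s + θ * (t - s) := by ring
  rw [this] at h
  linarith

/-- The excess `σ(t) - u t` is bounded below by a multiple of the distance of `t` to its zeros. -/
theorem exists_intervalSupport_sharp {a b u : ℝ} (ha : a ≤ u) (hb : u ≤ b) (hab : a < b) :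
    ∃ c, 0 < c ∧ ∀ t, ∃ t', intervalSupport a b t' = u * t' ∧
      c * |t - t'| ≤ intervalSupport a b t - u * t := by
  -- A side of `0` on which the excess is identically zero needs no correction;
  -- on the other side the point is moved to `0`.
  have hpos : ∀ t, 0 ≤ t → intervalSupport a b t = b * t := fun t ht =>
    max_eq_right (mul_le_mul_of_nonneg_right hab.le ht)
  have hneg : ∀ t, t ≤ 0 → intervalSupport a b t = a * t := fun t ht =>
    max_eq_left (mul_le_mul_of_nonpos_right hab.le ht)
  rcases eq_or_lt_of_le ha with rfl | ha'
  · refine ⟨b - a, by linarith, fun t => ?_⟩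
    rcases le_total 0 t with ht | ht
    · refine ⟨0, by simp, ?_⟩
      rw [hpos t ht, sub_zero, abs_of_nonneg ht]; linarith
    · exact ⟨t, hneg t ht, by simp [hneg t ht]⟩
  rcases eq_or_lt_of_le hb with rfl | hb'
  · refine ⟨u - a, by linarith, fun t => ?_⟩
    rcases le_total 0 t with ht | ht
    · exact ⟨t, hpos t ht, by simp [hpos t ht]⟩
    · refine ⟨0, by simp, ?_⟩
      rw [hneg t ht, sub_zero, abs_of_nonpos ht]; linarith
  · refine ⟨min (u - a) (b - u), lt_min (by linarith) (by linarith), fun t => ⟨0, by simp, ?_⟩⟩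
    rw [sub_zero]
    rcases le_total 0 t with ht | ht
    · rw [hpos t ht, abs_of_nonneg ht, ← sub_mul]
      exact mul_le_mul_of_nonneg_right (min_le_right _ _) ht
    · rw [hneg t ht, abs_of_nonpos ht]
      have := mul_le_mul_of_nonpos_right (min_le_left (u - a) (b - u)) ht
      linarith

/-! ### The weighted `ℓ¹` norm as a real function on its domain -/

variable {X : Type*} [NormedAddCommGroup X] [InnerProductSpace ℝ X]
variable {Y : Type*} [NormedAddCommGroup Y] [InnerProductSpace ℝ Y]
variable {N : Set ℕ} (e : HilbertBasis N ℝ X) (a b : N → ℝ)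

/-- The effective domain of the weighted `ℓ¹` norm with intervals `[a k, b k]`. -/
def l1Domain : Set X :=
  {x | Summable fun k => intervalSupport (a k) (b k) (inner ℝ x (e k))}

/-- The weighted `ℓ¹` norm with intervals `[a k, b k]` as a real number; only meaningful on
`l1Domain e a b`, since the sum is `0` by convention elsewhere. -/
def realL1 (x : X) : ℝ := ∑' k, intervalSupport (a k) (b k) (inner ℝ x (e k))

/-- The objective as a real number; only meaningful on `l1Domain e a b`. -/
def realObjective (A : X →L[ℝ] Y) (y : Y) (x : X) : ℝ := realL1 e a b x + leastSquares A y x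

variable {e a b} {ω : ℝ}

theorem intervalSupport_nonneg {a b : ℝ} (hω : 0 < ω) (ha : a ≤ -ω) (hb : ω ≤ b) (t : ℝ) :
    0 ≤ intervalSupport a b t :=
  (mul_nonneg hω.le (abs_nonneg t)).trans (abs_le_intervalSupport ha hb t)

theorem coe_ennreal_tsum {ι : Type*} (f : ι → ENNReal) :
    ((∑' i, f i : ENNReal) : EReal) = ∑' i, (f i : EReal) := by
  let c : ENNReal →+ EReal := ⟨⟨fun x => (x : EReal), rfl⟩, EReal.coe_ennreal_add⟩
  exact (ENNReal.summable.hasSum.map c continuous_coe_ennreal_ereal).tsum_eq.symm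

theorem weightedL1_eq_coe_ennreal (hω : 0 < ω) (ha : ∀ k, a k ≤ -ω) (hb : ∀ k, ω ≤ b k) (x : X) :
    weightedL1 e (fun k => Icc (a k) (b k)) x =
      ((∑' k, ENNReal.ofReal (intervalSupport (a k) (b k) (inner ℝ x (e k))) : ENNReal) :
        EReal) := by
  rw [coe_ennreal_tsum, weightedL1]
  congr 1 with k
  rw [supportFun_Icc (by linarith [ha k, hb k]), EReal.coe_ennreal_ofReal,
    max_eq_left (intervalSupport_nonneg hω (ha k) (hb k) _)]

theorem weightedL1_of_mem (hω : 0 < ω) (ha : ∀ k, a k ≤ -ω) (hb : ∀ k, ω ≤ b k) {x : X}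
    (hx : x ∈ l1Domain e a b) :
    weightedL1 e (fun k => Icc (a k) (b k)) x = (realL1 e a b x : EReal) := by
  have h0 := fun k => intervalSupport_nonneg hω (ha k) (hb k) (inner ℝ x (e k))
  rw [weightedL1_eq_coe_ennreal hω ha hb, ← ENNReal.ofReal_tsum_of_nonneg h0 hx,
    EReal.coe_ennreal_ofReal, max_eq_left (tsum_nonneg h0), realL1]

theorem weightedL1_of_notMem (hω : 0 < ω) (ha : ∀ k, a k ≤ -ω) (hb : ∀ k, ω ≤ b k) {x : X}
    (hx : x ∉ l1Domain e a b) :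
    weightedL1 e (fun k => Icc (a k) (b k)) x = ⊤ := by
  rw [weightedL1_eq_coe_ennreal hω ha hb, EReal.coe_ennreal_eq_top_iff]
  by_contra h
  refine hx ?_
  have := ENNReal.summable_toReal h
  simpa only [l1Domain, mem_ofPred_eq,
    ENNReal.toReal_ofReal (intervalSupport_nonneg hω (ha _) (hb _) _)] using this

theorem objective_of_mem (hω : 0 < ω) (ha : ∀ k, a k ≤ -ω) (hb : ∀ k, ω ≤ b k)
    (A : X →L[ℝ] Y) (y : Y) {x : X} (hx : x ∈ l1Domain e a b) :
    objective e (fun k => Icc (a k) (b k)) A y x = (realObjective e a b A y x : EReal) := by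
  rw [objective, weightedL1_of_mem hω ha hb hx, realObjective, EReal.coe_add]

theorem objective_of_notMem (hω : 0 < ω) (ha : ∀ k, a k ≤ -ω) (hb : ∀ k, ω ≤ b k)
    (A : X →L[ℝ] Y) (y : Y) {x : X} (hx : x ∉ l1Domain e a b) :
    objective e (fun k => Icc (a k) (b k)) A y x = ⊤ := by
  rw [objective, weightedL1_of_notMem hω ha hb hx, EReal.top_add_coe]

theorem zero_mem_l1Domain : (0 : X) ∈ l1Domain e a b := by
  simp [l1Domain, summable_zero]

theorem isMinimizer_objective_iff (hω : 0 < ω) (ha : ∀ k, a k ≤ -ω) (hb : ∀ k, ω ≤ b k)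
    (A : X →L[ℝ] Y) (y : Y) (p : X) :
    IsMinimizer (objective e (fun k => Icc (a k) (b k)) A y) p ↔
      p ∈ l1Domain e a b ∧
        ∀ z ∈ l1Domain e a b, realObjective e a b A y p ≤ realObjective e a b A y z := by
  simp only [IsMinimizer, isMinOn_univ_iff]
  constructor
  · intro h
    have hp : p ∈ l1Domain e a b := by
      by_contra hp
      have := h 0
      rw [objective_of_notMem hω ha hb A y hp, objective_of_mem hω ha hb A y zero_mem_l1Domain,
        top_le_iff] at this
      exact EReal.coe_ne_top _ this
    refine ⟨hp, fun z hz => ?_⟩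
    have := h z
    rwa [objective_of_mem hω ha hb A y hp, objective_of_mem hω ha hb A y hz,
      EReal.coe_le_coe_iff] at this
  · rintro ⟨hp, h⟩ z
    by_cases hz : z ∈ l1Domain e a b
    · rw [objective_of_mem hω ha hb A y hp, objective_of_mem hω ha hb A y hz,
        EReal.coe_le_coe_iff]
      exact h z hz
    · rw [objective_of_notMem hω ha hb A y hz]
      exact le_top

/-- The `ℓ²` norm is dominated by the `ℓ¹` norm. -/
theorem norm_le_of_hasSum_abs_inner_le {x : X} {g : N → ℝ} {s : ℝ} (hg : HasSum g s)
    (h : ∀ k, |inner ℝ x (e k)| ≤ g k) : ‖x‖ ≤ s := by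
  refine (e.hasSum_repr x).norm_le_of_bounded hg fun k => ?_
  rw [norm_smul, e.orthonormal.1 k, mul_one, e.repr_apply_apply, real_inner_comm]
  exact h k

theorem norm_le_realL1 (hω : 0 < ω) (ha : ∀ k, a k ≤ -ω) (hb : ∀ k, ω ≤ b k) {x : X}
    (hx : x ∈ l1Domain e a b) : ω * ‖x‖ ≤ realL1 e a b x := by
  rw [← le_div_iff₀' hω, ← inv_mul_eq_div]
  refine norm_le_of_hasSum_abs_inner_le (e := e) (hx.hasSum.mul_left ω⁻¹) fun k => ?_
  rw [inv_mul_eq_div, le_div_iff₀' hω]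
  exact abs_le_intervalSupport (ha k) (hb k) _

/-! ### Algebra of the domain -/

theorem l1Domain_add (hω : 0 < ω) (ha : ∀ k, a k ≤ -ω) (hb : ∀ k, ω ≤ b k) {x z : X}
    (hx : x ∈ l1Domain e a b) (hz : z ∈ l1Domain e a b) : x + z ∈ l1Domain e a b := by
  refine Summable.of_nonneg_of_le (fun k => intervalSupport_nonneg hω (ha k) (hb k) _)
    (fun k => ?_) (hx.add hz)
  rw [inner_add_left]
  exact intervalSupport_add_le _ _ _ _

theorem l1Domain_smul {x : X} (hx : x ∈ l1Domain e a b) {c : ℝ} (hc : 0 ≤ c) :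
    c • x ∈ l1Domain e a b := by
  simp only [l1Domain, mem_ofPred_eq, real_inner_smul_left, intervalSupport_mul _ _ _ hc]
  exact hx.mul_left c

theorem realL1_add_le (hω : 0 < ω) (ha : ∀ k, a k ≤ -ω) (hb : ∀ k, ω ≤ b k) {x z : X}
    (hx : x ∈ l1Domain e a b) (hz : z ∈ l1Domain e a b) :
    realL1 e a b (x + z) ≤ realL1 e a b x + realL1 e a b z := by
  rw [realL1, realL1, realL1, ← hx.tsum_add hz]
  refine (l1Domain_add hω ha hb hx hz).tsum_le_tsum (fun k => ?_) (hx.add hz)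
  rw [inner_add_left]
  exact intervalSupport_add_le _ _ _ _

theorem realL1_smul (x : X) {c : ℝ} (hc : 0 ≤ c) :
    realL1 e a b (c • x) = c * realL1 e a b x := by
  simp only [realL1, real_inner_smul_left, intervalSupport_mul _ _ _ hc, tsum_mul_left]

theorem inner_smul_basis (c : ℝ) (j k : N) :
    inner ℝ (c • e j) (e k) = if k = j then c else 0 := by
  classical
  rw [real_inner_smul_left, orthonormal_iff_ite.1 e.orthonormal]
  simp [eq_comm]

theorem smul_basis_mem_l1Domain (c : ℝ) (k : N) : c • e k ∈ l1Domain e a b := by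
  refine summable_of_ne_finset_zero (s := {k}) fun j hj => ?_
  rw [inner_smul_basis, if_neg (by simpa using hj), intervalSupport_zero]

theorem realL1_smul_basis (c : ℝ) (k : N) :
    realL1 e a b (c • e k) = intervalSupport (a k) (b k) c := by
  rw [realL1, tsum_eq_single k fun j hj => by
    rw [inner_smul_basis, if_neg hj, intervalSupport_zero], inner_smul_basis, if_pos rfl]

theorem summable_inner_mul (u x : X) : Summable fun k => inner ℝ u (e k) * inner ℝ x (e k) := by
  simpa only [real_inner_comm x] using e.summable_inner_mul_inner u x

theorem tsum_inner_mul (u x : X) :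
    ∑' k, inner ℝ u (e k) * inner ℝ x (e k) = inner ℝ u x := by
  simpa only [real_inner_comm x] using e.tsum_inner_mul_inner u x

/-! ### Subgradients of the weighted `ℓ¹` norm -/

/-- The coordinates of a subgradient lie in the intervals. -/
theorem subgradient_mem (hω : 0 < ω) (ha : ∀ k, a k ≤ -ω) (hb : ∀ k, ω ≤ b k)
    {p u : X} (hpd : p ∈ l1Domain e a b)
    (hu : ∀ z ∈ l1Domain e a b, realL1 e a b p + inner ℝ u (z - p) ≤ realL1 e a b z) (k : N) :
    a k ≤ inner ℝ u (e k) ∧ inner ℝ u (e k) ≤ b k := by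
  have h : ∀ c : ℝ, c * inner ℝ u (e k) ≤ intervalSupport (a k) (b k) c := by
    intro c
    have h1 := hu _ (l1Domain_add hω ha hb hpd (smul_basis_mem_l1Domain c k))
    have h2 := realL1_add_le hω ha hb hpd (smul_basis_mem_l1Domain (e := e) (a := a) (b := b) c k)
    rw [realL1_smul_basis] at h2
    rw [add_sub_cancel_left, real_inner_smul_right] at h1
    linarith
  have hab : a k ≤ b k := by linarith [ha k, hb k]
  have h1 := h 1
  have h2 := h (-1)
  rw [intervalSupport, max_eq_right (by linarith)] at h1
  rw [intervalSupport, max_eq_left (by linarith)] at h2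
  constructor <;> linarith

/-- Coordinatewise equality in Young's inequality at a minimizer. -/
theorem intervalSupport_eq_of_subgradient (hω : 0 < ω) (ha : ∀ k, a k ≤ -ω) (hb : ∀ k, ω ≤ b k)
    {p u : X} (hpd : p ∈ l1Domain e a b)
    (hu : ∀ z ∈ l1Domain e a b, realL1 e a b p + inner ℝ u (z - p) ≤ realL1 e a b z) (k : N) :
    intervalSupport (a k) (b k) (inner ℝ p (e k)) = inner ℝ u (e k) * inner ℝ p (e k) := by
  have hnn : ∀ k, 0 ≤ intervalSupport (a k) (b k) (inner ℝ p (e k)) -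
      inner ℝ u (e k) * inner ℝ p (e k) := fun k =>
    sub_nonneg.2 (mul_le_intervalSupport (subgradient_mem hω ha hb hpd hu k).1
      (subgradient_mem hω ha hb hpd hu k).2 _)
  have hsum := hpd.hasSum.sub (summable_inner_mul (e := e) u p).hasSum
  have h0 := hu 0 zero_mem_l1Domain
  have h3 : realL1 e a b (0 : X) = 0 := by simp [realL1]
  rw [h3, zero_sub, inner_neg_right, ← tsum_inner_mul (e := e) u p, realL1] at h0
  have hle := le_hasSum hsum k fun j _ => hnn j
  linarith [hnn k]

/-! ### Vectors supported on finitely many coordinates -/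

/-- The vector with coordinates `v` on the finite set `J` and zero elsewhere. -/
def ofCoords (e : HilbertBasis N ℝ X) (J : Finset N) : (J → ℝ) →L[ℝ] X :=
  ∑ k : J, (ContinuousLinearMap.proj k : (J → ℝ) →L[ℝ] ℝ).smulRight (e k)

theorem inner_ofCoords [DecidableEq N] (J : Finset N) (v : J → ℝ) (k : N) :
    inner ℝ (ofCoords e J v) (e k) = if h : k ∈ J then v ⟨k, h⟩ else 0 := by
  have h0 : ofCoords e J v = ∑ j : J, v j • e j := by
    simp [ofCoords]
  rw [h0, sum_inner]
  simp only [inner_smul_basis]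
  split_ifs with h
  · rw [Finset.sum_eq_single ⟨k, h⟩ ?_ fun hk => absurd (Finset.mem_univ _) hk, if_pos rfl]
    exact fun j _ hj => if_neg fun hk => hj (Subtype.ext hk.symm)
  · exact Finset.sum_eq_zero fun j _ => if_neg fun hk : k = j => h (hk ▸ j.2)

theorem ext_inner_basis {x z : X} (h : ∀ k, inner ℝ x (e k) = inner ℝ z (e k)) : x = z := by
  refine e.repr.injective (lp.ext (funext fun k => ?_))
  rw [e.repr_apply_apply, e.repr_apply_apply, real_inner_comm, h, real_inner_comm]

/-! ### Sharpness of the weighted `ℓ¹` norm -/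

theorem finite_setOf_le_abs_inner (u : X) {δ : ℝ} (hδ : 0 < δ) :
    {k | δ ≤ |inner ℝ u (e k)|}.Finite := by
  have h := (e.orthonormal.inner_products_summable u).tendsto_cofinite_zero
  have h2 := h.eventually_lt_const (show (0 : ℝ) < δ ^ 2 by positivity)
  refine h2.subset fun k hk hk' => ?_
  replace hk' : ‖inner ℝ (e k) u‖ ^ 2 < δ ^ 2 := hk'
  rw [real_inner_comm, Real.norm_eq_abs] at hk'
  exact absurd (pow_le_pow_left₀ hδ.le hk 2) (not_le.2 hk')

/-- Every point has a nearby one with no coordinatewise excess and with support in a fixed finite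
set; the distance in each coordinate is controlled by the excess, uniformly in the coordinate. -/
theorem exists_uniform_sharp (hω : 0 < ω) (ha : ∀ k, a k ≤ -ω) (hb : ∀ k, ω ≤ b k) (u : X)
    (hu : ∀ k, a k ≤ inner ℝ u (e k) ∧ inner ℝ u (e k) ≤ b k) :
    ∃ J : Finset N, ∃ c, 0 < c ∧ ∀ k t, ∃ t',
      intervalSupport (a k) (b k) t' = inner ℝ u (e k) * t' ∧ (k ∉ J → t' = 0) ∧
      c * |t - t'| ≤ intervalSupport (a k) (b k) t - inner ℝ u (e k) * t := by
  -- Off the finite set `J` of coordinates with `|u_k| ≥ ω / 2`, the excess is at least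
  -- `ω / 2 * |t|`, hence it vanishes at `0` only.
  set J := (finite_setOf_le_abs_inner (e := e) u (half_pos hω)).toFinset with hJ
  choose c hc τ hτ using fun k => exists_intervalSupport_sharp (hu k).1 (hu k).2
    (show a k < b k by linarith [ha k, hb k])
  obtain ⟨c₀, hc₀⟩ : ∃ c₀, 0 < c₀ ∧ ∀ k ∈ J, c₀ ≤ c k := by
    have h : ∀ᶠ m in 𝓝[>] (0 : ℝ), ∀ k ∈ J, m ≤ c k :=
      J.eventually_all.2 fun k _ => (eventually_le_nhds (hc k)).filter_mono nhdsWithin_le_nhds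
    obtain ⟨m, hm, hm0⟩ := (h.and self_mem_nhdsWithin).exists
    exact ⟨m, hm0, hm⟩
  refine ⟨J, min c₀ (ω / 2), lt_min hc₀.1 (half_pos hω), fun k t => ?_⟩
  by_cases hk : k ∈ J
  · exact ⟨_, (hτ k t).1, fun h => absurd hk h,
      (mul_le_mul_of_nonneg_right ((min_le_left _ _).trans (hc₀.2 k hk)) (abs_nonneg _)).trans
        (hτ k t).2⟩
  · refine ⟨0, by simp, fun _ => rfl, ?_⟩
    have h1 : |inner ℝ u (e k)| < ω / 2 := by simpa [hJ] using hk
    have h2 := abs_le_intervalSupport (ha k) (hb k) t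
    have h3 : inner ℝ u (e k) * t ≤ ω / 2 * |t| := by
      refine (le_abs_self _).trans ?_
      rw [abs_mul]
      exact mul_le_mul_of_nonneg_right h1.le (abs_nonneg _)
    have h4 := mul_le_mul_of_nonneg_right (min_le_right c₀ (ω / 2)) (abs_nonneg t)
    rw [sub_zero]
    linarith

/-! ### Existence of minimizers -/

theorem iSup_ofReal_inner_sub (w : Y) :
    ⨆ v : Y, ENNReal.ofReal (inner ℝ w v - 1 / 2 * ‖v‖ ^ 2) =
      ENNReal.ofReal (1 / 2 * ‖w‖ ^ 2) := by
  refine le_antisymm (iSup_le fun v => ENNReal.ofReal_le_ofReal ?_) ?_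
  · have := sq_nonneg ‖w - v‖
    rw [norm_sub_sq_real] at this
    linarith
  · refine le_trans (le_of_eq ?_) (le_iSup _ w)
    rw [real_inner_self_eq_norm_sq]
    ring_nf

variable [CompleteSpace X] [CompleteSpace Y]

/-- The objective transported to the weak dual, written as a sum of suprema of weakly continuous
functions so that its weak lower semicontinuity is apparent. -/
def dualObjective (e : HilbertBasis N ℝ X) (a b : N → ℝ) (A : X →L[ℝ] Y) (y : Y)
    (φ : WeakDual ℝ X) : ENNReal :=
  ∑' k, ENNReal.ofReal (intervalSupport (a k) (b k) (φ (e k))) +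
    ⨆ v : Y, ENNReal.ofReal (φ (A.adjoint v) - inner ℝ y v - 1 / 2 * ‖v‖ ^ 2)

theorem lowerSemicontinuous_dualObjective (A : X →L[ℝ] Y) (y : Y) :
    LowerSemicontinuous (dualObjective e a b A y) := by
  have hev : ∀ v : X, Continuous fun φ : WeakDual ℝ X => φ v := WeakDual.eval_continuous
  refine (lowerSemicontinuous_tsum fun k => Continuous.lowerSemicontinuous ?_).add
    (lowerSemicontinuous_iSup fun v => Continuous.lowerSemicontinuous ?_)
  · exact ENNReal.continuous_ofReal.comp ((continuous_intervalSupport _ _).comp (hev _))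
  · exact ENNReal.continuous_ofReal.comp
      (((hev _).sub continuous_const).sub continuous_const)

theorem coe_dualObjective (hω : 0 < ω) (ha : ∀ k, a k ≤ -ω) (hb : ∀ k, ω ≤ b k)
    (A : X →L[ℝ] Y) (y : Y) (x : X) :
    (dualObjective e a b A y (WeakDual.toStrongDual.symm (InnerProductSpace.toDual ℝ X x)) :
      EReal) = objective e (fun k => Icc (a k) (b k)) A y x := by
  have happ : ∀ v, (WeakDual.toStrongDual.symm (InnerProductSpace.toDual ℝ X x)) v =
      inner ℝ x v := fun v => InnerProductSpace.toDual_apply_apply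
  have : ∀ v, inner ℝ x (A.adjoint v) - inner ℝ y v - 1 / 2 * ‖v‖ ^ 2 =
      inner ℝ (A x - y) v - 1 / 2 * ‖v‖ ^ 2 := fun v => by
    rw [ContinuousLinearMap.adjoint_inner_right, inner_sub_left]
  simp only [dualObjective, happ, this, iSup_ofReal_inner_sub]
  rw [EReal.coe_ennreal_add, objective, weightedL1_eq_coe_ennreal hω ha hb,
    EReal.coe_ennreal_ofReal, max_eq_left (by positivity), leastSquares]

theorem exists_isMinimizer_objective (hω : 0 < ω) (ha : ∀ k, a k ≤ -ω) (hb : ∀ k, ω ≤ b k)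
    (A : X →L[ℝ] Y) (y : Y) :
    ∃ p, IsMinimizer (objective e (fun k => Icc (a k) (b k)) A y) p := by
  -- Outside the ball of radius `R` the objective exceeds its value `‖y‖ ^ 2 / 2` at the origin.
  set R := ω⁻¹ * (1 / 2 * ‖y‖ ^ 2) with hR
  obtain ⟨φ, hφK, hφ⟩ := LowerSemicontinuousOn.exists_isMinOn
    (s := WeakDual.toStrongDual ⁻¹' Metric.closedBall (0 : StrongDual ℝ X) R)
    ⟨0, by simpa using show 0 ≤ R by positivity⟩ (WeakDual.isCompact_closedBall 0 R)
    ((lowerSemicontinuous_dualObjective (e := e) (a := a) (b := b) A y).lowerSemicontinuousOn _)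
  obtain ⟨p, rfl⟩ := (WeakDual.toStrongDual.symm.surjective.comp
    (InnerProductSpace.toDual ℝ X).surjective) φ
  have hball : ∀ z : X, ‖z‖ ≤ R → objective e (fun k => Icc (a k) (b k)) A y p ≤
      objective e (fun k => Icc (a k) (b k)) A y z := by
    intro z hz
    rw [← coe_dualObjective hω ha hb, ← coe_dualObjective hω ha hb,
      EReal.coe_ennreal_le_coe_ennreal_iff]
    exact hφ (by simpa using hz)
  refine ⟨p, isMinOn_univ_iff.2 fun z => ?_⟩
  rcases le_or_gt ‖z‖ R with hz | hz
  · exact hball z hz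
  refine (hball 0 (by simpa using show 0 ≤ R by positivity)).trans ?_
  by_cases hzd : z ∈ l1Domain e a b
  · rw [objective_of_mem hω ha hb A y hzd, objective_of_mem hω ha hb A y zero_mem_l1Domain,
      EReal.coe_le_coe_iff, realObjective, realObjective, leastSquares, leastSquares]
    have h1 := norm_le_realL1 hω ha hb hzd
    have h2 : 1 / 2 * ‖y‖ ^ 2 < ω * ‖z‖ := by
      rwa [hR, inv_mul_lt_iff₀ hω] at hz
    have h3 : realL1 e a b (0 : X) = 0 := by simp [realL1]
    rw [h3, map_zero, zero_sub, norm_neg]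
    have := sq_nonneg ‖A z - y‖
    linarith
  · rw [objective_of_notMem hω ha hb A y hzd]
    exact le_top

/-! ### Optimality conditions -/

/-- Exact second order expansion of the least squares term. -/
theorem leastSquares_eq (A : X →L[ℝ] Y) (y : Y) (p z : X) :
    leastSquares A y z = leastSquares A y p - inner ℝ (A.adjoint (y - A p)) (z - p) +
      1 / 2 * ‖A (z - p)‖ ^ 2 := by
  have h : A z - y = (A p - y) + A (z - p) := by rw [map_sub]; abel
  rw [leastSquares, leastSquares, h, norm_add_sq_real, ContinuousLinearMap.adjoint_inner_left,
    ← neg_sub (A p) y, inner_neg_left]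
  ring

/-- Fermat's rule: at a minimizer `p`, the residual `A* (y - A p)` is a subgradient of the
weighted `ℓ¹` norm. -/
theorem realL1_subgradient (hω : 0 < ω) (ha : ∀ k, a k ≤ -ω) (hb : ∀ k, ω ≤ b k)
    {A : X →L[ℝ] Y} {y : Y} {p : X}
    (hp : IsMinimizer (objective e (fun k => Icc (a k) (b k)) A y) p)
    {z : X} (hz : z ∈ l1Domain e a b) :
    realL1 e a b p + inner ℝ (A.adjoint (y - A p)) (z - p) ≤ realL1 e a b z := by
  obtain ⟨hpd, hmin⟩ := (isMinimizer_objective_iff hω ha hb A y p).1 hp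
  have key : ∀ t : ℝ, 0 < t → t ≤ 1 →
      realL1 e a b p + inner ℝ (A.adjoint (y - A p)) (z - p) - realL1 e a b z ≤
        t * (1 / 2 * ‖A (z - p)‖ ^ 2) := by
    intro t ht ht1
    have hpt := l1Domain_smul hpd (sub_nonneg.2 ht1)
    have hzt := l1Domain_smul hz ht.le
    have h1 := hmin _ (l1Domain_add hω ha hb hpt hzt)
    have h2 := realL1_add_le hω ha hb hpt hzt
    rw [realL1_smul _ (sub_nonneg.2 ht1), realL1_smul _ ht.le] at h2
    have h3 : (1 - t) • p + t • z - p = t • (z - p) := by module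
    rw [realObjective, realObjective, leastSquares_eq A y p ((1 - t) • p + t • z), h3, map_smul,
      norm_smul, real_inner_smul_right, mul_pow, Real.norm_eq_abs, sq_abs] at h1
    have h4 : t * (realL1 e a b p + inner ℝ (A.adjoint (y - A p)) (z - p) - realL1 e a b z) ≤
        t * (t * (1 / 2 * ‖A (z - p)‖ ^ 2)) := by linarith
    exact le_of_mul_le_mul_left h4 ht
  have hlim : Tendsto (fun t : ℝ => t * (1 / 2 * ‖A (z - p)‖ ^ 2)) (𝓝[>] 0) (𝓝 0) := by
    have : Tendsto (fun t : ℝ => t * (1 / 2 * ‖A (z - p)‖ ^ 2)) (𝓝 0)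
        (𝓝 (0 * (1 / 2 * ‖A (z - p)‖ ^ 2))) := by
      exact (continuous_id.mul continuous_const).tendsto 0
    rw [zero_mul] at this
    exact this.mono_left nhdsWithin_le_nhds
  have := ge_of_tendsto hlim (b := realL1 e a b p + inner ℝ (A.adjoint (y - A p)) (z - p) -
    realL1 e a b z) (by
      filter_upwards [Ioc_mem_nhdsGT (zero_lt_one' ℝ)] with t ht using key t ht.1 ht.2)
  linarith

/-! ### The set of minimizers and the quadratic error bound -/


/-- The gap to the minimum splits into coordinatewise excesses and a quadratic term. -/
theorem realObjective_sub_eq (A : X →L[ℝ] Y) (y : Y) {p : X}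
    (hp : ∀ k, intervalSupport (a k) (b k) (inner ℝ p (e k)) =
      inner ℝ (A.adjoint (y - A p)) (e k) * inner ℝ p (e k))
    {x : X} (hx : x ∈ l1Domain e a b) :
    realObjective e a b A y x - realObjective e a b A y p =
      ∑' k, (intervalSupport (a k) (b k) (inner ℝ x (e k)) -
        inner ℝ (A.adjoint (y - A p)) (e k) * inner ℝ x (e k)) + 1 / 2 * ‖A (x - p)‖ ^ 2 := by
  rw [hx.tsum_sub (summable_inner_mul _ _), tsum_inner_mul, realObjective, realObjective,
    leastSquares_eq A y p x, realL1, realL1, tsum_congr hp, tsum_inner_mul, inner_sub_right]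
  ring

/-- Given one minimizer `p` with residual `u`, the minimizers are the points `z` with the same
image as `p` whose coordinates satisfy `σ_k(z_k) = u_k z_k`. -/
theorem isMinimizer_objective_iff_of_isMinimizer (hω : 0 < ω) (ha : ∀ k, a k ≤ -ω)
    (hb : ∀ k, ω ≤ b k) {A : X →L[ℝ] Y} {y : Y} {p : X}
    (hp : IsMinimizer (objective e (fun k => Icc (a k) (b k)) A y) p) (z : X) :
    IsMinimizer (objective e (fun k => Icc (a k) (b k)) A y) z ↔ A z = A p ∧
      ∀ k, intervalSupport (a k) (b k) (inner ℝ z (e k)) =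
        inner ℝ (A.adjoint (y - A p)) (e k) * inner ℝ z (e k) := by
  obtain ⟨hpd, hpmin⟩ := (isMinimizer_objective_iff hω ha hb A y p).1 hp
  have hu := fun z => realL1_subgradient hω ha hb hp (z := z)
  have hmem := subgradient_mem hω ha hb hpd hu
  have hpe := intervalSupport_eq_of_subgradient hω ha hb hpd hu
  have hnn : ∀ (x : X) k, 0 ≤ intervalSupport (a k) (b k) (inner ℝ x (e k)) -
      inner ℝ (A.adjoint (y - A p)) (e k) * inner ℝ x (e k) := fun x k =>
    sub_nonneg.2 (mul_le_intervalSupport (hmem k).1 (hmem k).2 _)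
  rw [isMinimizer_objective_iff hω ha hb]
  constructor
  · rintro ⟨hz, hzmin⟩
    have h1 := realObjective_sub_eq A y hpe hz
    have h2 := hzmin p hpd
    have h3 := tsum_nonneg (L := .unconditional N) (hnn z)
    have h4 : ‖A (z - p)‖ ^ 2 = 0 := by
      have := sq_nonneg ‖A (z - p)‖
      linarith
    have h5 : A z - A p = 0 := by simpa using h4
    refine ⟨sub_eq_zero.1 h5, fun k => ?_⟩
    have hs := (hz.sub (summable_inner_mul (A.adjoint (y - A p)) z)).le_tsum k
      fun j _ => hnn z j
    linarith [hnn z k]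
  · rintro ⟨hA, hz⟩
    have hzd : z ∈ l1Domain e a b := by
      simp only [l1Domain, mem_ofPred_eq, hz]
      exact summable_inner_mul _ _
    have h1 := realObjective_sub_eq A y hpe hzd
    simp only [hz, sub_self, tsum_zero, map_sub, hA, norm_zero] at h1
    refine ⟨hzd, fun x hx => ?_⟩
    have := hpmin x hx
    linarith

theorem isClosed_setOf_isMinimizer_objective (hω : 0 < ω) (ha : ∀ k, a k ≤ -ω)
    (hb : ∀ k, ω ≤ b k) {A : X →L[ℝ] Y} {y : Y} {p : X}
    (hp : IsMinimizer (objective e (fun k => Icc (a k) (b k)) A y) p) :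
    IsClosed {z | IsMinimizer (objective e (fun k => Icc (a k) (b k)) A y) z} := by
  simp only [isMinimizer_objective_iff_of_isMinimizer hω ha hb hp]
  rw [ofPred_and, ofPred_forall]
  refine (isClosed_eq A.continuous continuous_const).inter (isClosed_iInter fun k => ?_)
  exact isClosed_eq (by fun_prop) (by fun_prop)

/-- On sublevel sets the objective grows quadratically away from its set of minimizers. -/
theorem exists_quadratic_growth (hω : 0 < ω) (ha : ∀ k, a k ≤ -ω) (hb : ∀ k, ω ≤ b k)
    {A : X →L[ℝ] Y} {y : Y} {p : X}
    (hp : IsMinimizer (objective e (fun k => Icc (a k) (b k)) A y) p) {M : ℝ} (hM : 0 ≤ M) :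
    ∃ κ, 0 < κ ∧ ∀ x ∈ l1Domain e a b,
      realObjective e a b A y x - realObjective e a b A y p ≤ M →
      ∃ z, IsMinimizer (objective e (fun k => Icc (a k) (b k)) A y) z ∧
        ‖x - z‖ ^ 2 ≤ κ * (realObjective e a b A y x - realObjective e a b A y p) := by
  classical
  obtain ⟨hpd, -⟩ := (isMinimizer_objective_iff hω ha hb A y p).1 hp
  have hsub := fun z => realL1_subgradient hω ha hb hp (z := z)
  have hmem := subgradient_mem hω ha hb hpd hsub
  have hpe := intervalSupport_eq_of_subgradient hω ha hb hpd hsub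
  have hiff := isMinimizer_objective_iff_of_isMinimizer hω ha hb hp
  have hgap := fun x => realObjective_sub_eq A y hpe (x := x)
  set u := A.adjoint (y - A p) with hu
  obtain ⟨J, c, hc, hτ⟩ := exists_uniform_sharp hω ha hb u hmem
  choose τ hτ₁ hτ₂ hτ₃ using hτ
  obtain ⟨κ, hκ, hB⟩ := exists_conformal_preimage (A.comp (ofCoords e J))
  set T := ‖ofCoords e J‖ with hT
  have hT0 : 0 ≤ T := norm_nonneg _
  set P := c⁻¹ + T * κ * (‖A‖ * c⁻¹) with hP
  set Q := T * κ with hQ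
  refine ⟨2 * P ^ 2 * M + 4 * Q ^ 2 + 1, by positivity, fun x hx hxM => ?_⟩
  have hpJ : ∀ k, k ∉ J → inner ℝ p (e k) = 0 := fun k hk => by
    have h := hτ₃ k (inner ℝ p (e k))
    rw [hτ₂ k _ hk, hpe k, sub_self, sub_zero] at h
    exact abs_eq_zero.1 (le_antisymm (nonpos_of_mul_nonpos_right h hc) (abs_nonneg _))
  -- `v` is the clipped point, and `d` leads from it to `p`.
  set v : J → ℝ := fun k => τ k (inner ℝ x (e k)) with hv
  set pJ : J → ℝ := fun k => inner ℝ p (e k) with hpJ'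
  have hpv : ofCoords e J pJ = p := ext_inner_basis (e := e) fun k => by
    rw [inner_ofCoords]
    split_ifs with h
    · rfl
    · exact (hpJ k h).symm
  have hvk : ∀ k, inner ℝ (ofCoords e J v) (e k) = τ k (inner ℝ x (e k)) := fun k => by
    rw [inner_ofCoords]
    split_ifs with h
    · rfl
    · exact (hτ₂ k _ h).symm
  obtain ⟨d, hd, hBd, hdn⟩ := hB (pJ - v)
  have hBv : A.comp (ofCoords e J) (pJ - v) = A (p - ofCoords e J v) := by
    rw [ContinuousLinearMap.comp_apply, map_sub, hpv]
  refine ⟨ofCoords e J (v + d), (hiff _).2 ⟨?_, fun k => ?_⟩, ?_⟩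
  · rw [ContinuousLinearMap.comp_apply] at hBd
    rw [map_add, map_add, hBd, hBv, map_sub]
    abel
  · rw [inner_ofCoords]
    split_ifs with h
    · obtain ⟨θ, h0, h1, h2⟩ := hd ⟨k, h⟩
      rw [Pi.add_apply, h2, Pi.sub_apply]
      exact intervalSupport_eq_mul_of_mem_segment (hmem k).1 (hmem k).2 (hτ₁ k _) (hpe k) h0 h1
    · simp
  have hg := hgap x hx
  set r := realObjective e a b A y x - realObjective e a b A y p with hr
  set Φ := ∑' k, (intervalSupport (a k) (b k) (inner ℝ x (e k)) -
    inner ℝ u (e k) * inner ℝ x (e k)) with hΦ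
  set q := ‖A (x - p)‖ with hq
  have hΦ0 : 0 ≤ Φ := tsum_nonneg fun k =>
    sub_nonneg.2 (mul_le_intervalSupport (hmem k).1 (hmem k).2 _)
  have h1 : ‖x - ofCoords e J v‖ ≤ c⁻¹ * Φ := by
    refine norm_le_of_hasSum_abs_inner_le (e := e)
      ((hx.sub (summable_inner_mul u x)).hasSum.mul_left c⁻¹) fun k => ?_
    rw [inv_mul_eq_div, le_div_iff₀' hc, inner_sub_left, hvk]
    exact hτ₃ k _
  have h2 : ‖A (p - ofCoords e J v)‖ ≤ q + ‖A‖ * (c⁻¹ * Φ) := by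
    have : A (p - ofCoords e J v) = A (x - ofCoords e J v) - A (x - p) := by
      rw [← map_sub]; congr 1; abel
    rw [this]
    refine (norm_sub_le _ _).trans ?_
    rw [add_comm]
    exact add_le_add le_rfl ((A.le_opNorm _).trans
      (mul_le_mul_of_nonneg_left h1 (norm_nonneg _)))
  have h3 : ‖ofCoords e J d‖ ≤ Q * (q + ‖A‖ * (c⁻¹ * Φ)) := by
    refine ((ofCoords e J).le_opNorm d).trans ?_
    rw [hQ, mul_assoc]
    rw [hBv] at hdn
    exact mul_le_mul_of_nonneg_left (hdn.trans (mul_le_mul_of_nonneg_left h2 hκ)) hT0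
  have h4 : ‖x - ofCoords e J (v + d)‖ ≤ P * Φ + Q * q := by
    have : x - ofCoords e J (v + d) = (x - ofCoords e J v) - ofCoords e J d := by
      rw [map_add]; abel
    rw [this]
    refine (norm_sub_le _ _).trans ((add_le_add h1 h3).trans (le_of_eq ?_))
    rw [hP, hQ]; ring
  have hΦr : Φ ≤ r := by rw [hg]; linarith [sq_nonneg q]
  have hqr : q ^ 2 ≤ 2 * r := by linarith
  have hΦ2 : Φ ^ 2 ≤ M * r := by
    rw [sq]; exact mul_le_mul (hΦr.trans hxM) hΦr hΦ0 hM
  calc ‖x - ofCoords e J (v + d)‖ ^ 2 ≤ (P * Φ + Q * q) ^ 2 :=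
        pow_le_pow_left₀ (norm_nonneg _) h4 2
    _ ≤ 2 * P ^ 2 * Φ ^ 2 + 2 * Q ^ 2 * q ^ 2 := by linarith [sq_nonneg (P * Φ - Q * q)]
    _ ≤ 2 * P ^ 2 * (M * r) + 2 * Q ^ 2 * (2 * r) := by gcongr
    _ ≤ (2 * P ^ 2 * M + 4 * Q ^ 2 + 1) * r := by linarith

/-! ### One forward-backward step -/

theorem gradient_leastSquares (A : X →L[ℝ] Y) (y : Y) (x : X) :
    gradient (leastSquares A y) x = -A.adjoint (y - A x) := by
  refine HasGradientAt.gradient ?_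
  rw [hasGradientAt_iff_hasFDerivAt]
  have h : HasFDerivAt (fun x => A x - y) A x := A.hasFDerivAt.sub_const y
  have h2 := (h.norm_sq.const_mul (1 / 2))
  refine h2.congr_fderiv ?_
  ext z
  simp only [smul_apply, ContinuousLinearMap.comp_apply, innerSL_apply_apply,
    InnerProductSpace.toDual_apply_apply, inner_neg_left, ContinuousLinearMap.adjoint_inner_left,
    smul_eq_mul, nsmul_eq_mul]
  rw [← neg_sub (A x) y, inner_neg_left]
  push_cast
  ring

theorem norm_map_sq_le_of_lipschitzWith {A : X →L[ℝ] Y} {y : Y} {L : NNReal}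
    (hL : LipschitzWith L (gradient (leastSquares A y))) (d : X) :
    ‖A d‖ ^ 2 ≤ L * ‖d‖ ^ 2 := by
  have h := hL.dist_le_mul d 0
  rw [gradient_leastSquares, gradient_leastSquares, dist_eq_norm, dist_eq_norm, sub_zero,
    neg_sub_neg, ← map_sub, map_zero, sub_zero, sub_sub_cancel] at h
  calc ‖A d‖ ^ 2 = inner ℝ (A.adjoint (A d)) d := by
        rw [ContinuousLinearMap.adjoint_inner_left, real_inner_self_eq_norm_sq]
    _ ≤ ‖A.adjoint (A d)‖ * ‖d‖ := real_inner_le_norm _ _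
    _ ≤ L * ‖d‖ * ‖d‖ := by gcongr
    _ = L * ‖d‖ ^ 2 := by ring

/-- The proximity operator exists, and `(w - prox w) / l` is a subgradient at `prox w`. -/
theorem prox_weightedL1_spec (hω : 0 < ω) (ha : ∀ k, a k ≤ -ω) (hb : ∀ k, ω ≤ b k)
    {l : ℝ} (hl : 0 < l) (w : X) :
    prox (weightedL1 e fun k => Icc (a k) (b k)) l w ∈ l1Domain e a b ∧
    ∀ z ∈ l1Domain e a b,
      realL1 e a b (prox (weightedL1 e fun k => Icc (a k) (b k)) l w) +
        inner ℝ (l⁻¹ • (w - prox (weightedL1 e fun k => Icc (a k) (b k)) l w))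
          (z - prox (weightedL1 e fun k => Icc (a k) (b k)) l w) ≤ realL1 e a b z := by
  -- The problem defining `prox` is an instance of the least squares problem.
  set s := (√l)⁻¹ with hs
  have hss : s * s = l⁻¹ := by rw [hs, ← mul_inv, Real.mul_self_sqrt hl.le]
  have h_eq : (fun z : X => weightedL1 e (fun k => Icc (a k) (b k)) z +
      ((1 / (2 * l) * ‖z - w‖ ^ 2 : ℝ) : EReal)) =
      objective e (fun k => Icc (a k) (b k)) (s • ContinuousLinearMap.id ℝ X) (s • w) := by
    funext z
    rw [objective, leastSquares]
    congr 2
    rw [smul_apply, ContinuousLinearMap.id_apply, ← smul_sub, norm_smul,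
      mul_pow, Real.norm_eq_abs, sq_abs, sq s, hss]
    field_simp
  have hprox : IsMinimizer (objective e (fun k => Icc (a k) (b k))
      (s • ContinuousLinearMap.id ℝ X) (s • w))
      (prox (weightedL1 e fun k => Icc (a k) (b k)) l w) := by
    rw [prox, h_eq]
    exact Classical.epsilon_spec (exists_isMinimizer_objective hω ha hb _ _)
  refine ⟨((isMinimizer_objective_iff hω ha hb _ _ _).1 hprox).1, fun z hz => ?_⟩
  have h := realL1_subgradient hω ha hb hprox hz
  rw [ContinuousLinearMap.adjoint_inner_left] at h
  simp only [smul_apply, ContinuousLinearMap.id_apply, ← smul_sub] at h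
  rwa [real_inner_smul_left, real_inner_smul_right, ← mul_assoc, hss,
    ← real_inner_smul_left] at h

/-- The three-point inequality for a forward-backward step from `x` to `p`. -/
theorem forwardBackward_step_le (A : X →L[ℝ] Y) (y : Y) {l : ℝ} (hl : 0 < l) {x p z : X}
    (h : realL1 e a b p + inner ℝ (l⁻¹ • (x - l • gradient (leastSquares A y) x - p)) (z - p) ≤
      realL1 e a b z) :
    realObjective e a b A y p - realObjective e a b A y z ≤
      l⁻¹ * inner ℝ (x - p) (p - z) + 1 / 2 * ‖A (p - x)‖ ^ 2 - 1 / 2 * ‖A (z - x)‖ ^ 2 := by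
  have h1 : l⁻¹ • (x - l • gradient (leastSquares A y) x - p) =
      l⁻¹ • (x - p) + A.adjoint (y - A x) := by
    rw [gradient_leastSquares, smul_sub, smul_sub, smul_smul, inv_mul_cancel₀ hl.ne']
    module
  rw [h1, inner_add_left, real_inner_smul_left, ← neg_sub p z, inner_neg_right,
    inner_neg_right] at h
  have h2 : inner ℝ (A.adjoint (y - A x)) (p - z) =
      inner ℝ (A.adjoint (y - A x)) (p - x) - inner ℝ (A.adjoint (y - A x)) (z - x) := by
    rw [← inner_sub_right, sub_sub_sub_cancel_right]
  rw [realObjective, realObjective, leastSquares_eq A y x p, leastSquares_eq A y x z]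
  linarith

/-! ### Linear convergence -/

/-- A step that decreases the gap `r` by at least `c s²` to at most `K s²` contracts it. -/
theorem gap_contraction {K c r r' s : ℝ} (hK : 0 < K) (hc : 0 < c)
    (h1 : r' + c * s ^ 2 ≤ r) (h2 : r' ≤ K * s ^ 2) : r' ≤ K / (K + c) * r := by
  rw [div_mul_eq_mul_div, le_div_iff₀ (by positivity)]
  nlinarith

end ISTA

open Filter Topology in
theorem theorem4p6
    {X : Type*} [NormedAddCommGroup X] [InnerProductSpace ℝ X] [CompleteSpace X]
    [TopologicalSpace.SeparableSpace X]
    {Y : Type*} [NormedAddCommGroup Y] [InnerProductSpace ℝ Y] [CompleteSpace Y]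
    [TopologicalSpace.SeparableSpace Y]
    {N : Set ℕ} (e : HilbertBasis N ℝ X)
    (I : N → Set ℝ)
    (hI_interval : ∀ k, (I k).OrdConnected)
    (hI_closed : ∀ k, IsClosed (I k))
    (hI_bounded : ∀ k, Bornology.IsBounded (I k))
    (ω : ℝ) (hω : 0 < ω) (hI_omega : ∀ k, Set.Icc (-ω) ω ⊆ I k)
    (A : X →L[ℝ] Y) (y : Y)
    (L : NNReal) (hL : 0 < L) (hLip : LipschitzWith L (gradient (ISTA.leastSquares A y)))
    (l : ℝ) (hl_pos : 0 < l) (hl_lt : l < 2 / (L : ℝ))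
    (x₀ : X) (x : ℕ → X)
    (hx : x = ISTA.forwardBackward (ISTA.weightedL1 e I) (ISTA.leastSquares A y) l x₀) :
    ∃ xbar : X,
      ISTA.IsMinimizer (ISTA.objective e I A y) xbar ∧
      Filter.Tendsto x Filter.atTop (nhds xbar) ∧
      ∃ ε : ℝ, 0 < ε ∧ ε < 1 ∧ ∃ C : ℝ, 0 < C ∧ ∀ n : ℕ, 1 ≤ n →
        ISTA.objective e I A y (x n) - ⨅ z : X, ISTA.objective e I A y z ≤
          ((ε ^ n : ℝ) : EReal) *
            (ISTA.objective e I A y x₀ - ⨅ z : X, ISTA.objective e I A y z) ∧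
        ‖x (n + 1) - xbar‖ ≤ C * Real.sqrt ε ^ n := by
  obtain ⟨a, b, rfl⟩ : ∃ a b : N → ℝ, I = fun k => Set.Icc (a k) (b k) := by
    refine ⟨fun k => sInf (I k), fun k => sSup (I k), funext fun k => ?_⟩
    have hne : (I k).Nonempty := ⟨0, hI_omega k ⟨by linarith, hω.le⟩⟩
    exact eq_Icc_of_connected_compact
      ⟨hne, (hI_interval k).isPreconnected⟩
      (Metric.isCompact_of_isClosed_isBounded (hI_closed k) (hI_bounded k))
  have ha : ∀ k, a k ≤ -ω := fun k => (hI_omega k ⟨le_rfl, by linarith⟩).1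
  have hb : ∀ k, ω ≤ b k := fun k => (hI_omega k ⟨by linarith, le_rfl⟩).2
  have hx0 : x 0 = x₀ := by rw [hx]; rfl
  have hxs : ∀ n, x (n + 1) = ISTA.prox (ISTA.weightedL1 e fun k => Set.Icc (a k) (b k)) l
      (x n - l • gradient (ISTA.leastSquares A y) (x n)) := fun n => by rw [hx]; rfl
  have hdom : ∀ n, x (n + 1) ∈ ISTA.l1Domain e a b := fun n => by
    rw [hxs]; exact (ISTA.prox_weightedL1_spec hω ha hb hl_pos _).1
  have hstep : ∀ n, ∀ z ∈ ISTA.l1Domain e a b,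
      ISTA.realObjective e a b A y (x (n + 1)) - ISTA.realObjective e a b A y z ≤
        l⁻¹ * inner ℝ (x n - x (n + 1)) (x (n + 1) - z) + 1 / 2 * ‖A (x (n + 1) - x n)‖ ^ 2 -
          1 / 2 * ‖A (z - x n)‖ ^ 2 := fun n z hz => by
    have h := (ISTA.prox_weightedL1_spec (e := e) hω ha hb hl_pos
      (x n - l • gradient (ISTA.leastSquares A y) (x n))).2 z hz
    rw [← hxs] at h
    exact ISTA.forwardBackward_step_le A y hl_pos h
  obtain ⟨p, hp⟩ := ISTA.exists_isMinimizer_objective (e := e) hω ha hb A y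
  obtain ⟨hpd, hpmin⟩ := (ISTA.isMinimizer_objective_iff hω ha hb A y p).1 hp
  set F := ISTA.realObjective e a b A y with hF
  have hinf : ⨅ z, ISTA.objective e (fun k => Set.Icc (a k) (b k)) A y z = (F p : EReal) := by
    rw [← ISTA.objective_of_mem hω ha hb A y hpd]
    exact le_antisymm (iInf_le _ p) (le_iInf (isMinOn_univ_iff.1 hp))
  have hL' : (0 : ℝ) < L := hL
  set c := l⁻¹ - L / 2 with hc_def
  have hc : 0 < c := by
    rw [hc_def, sub_pos, ← inv_div]
    exact (inv_lt_inv₀ (by positivity) hl_pos).2 hl_lt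
  -- Comparison with `x n` itself: sufficient decrease, with `c > 0` because `l < 2 / L`.
  have hdec : ∀ n, x n ∈ ISTA.l1Domain e a b →
      (F (x (n + 1)) - F p) + c * ‖x n - x (n + 1)‖ ^ 2 ≤ F (x n) - F p := by
    intro n hn
    have h := hstep n _ hn
    have h2 := ISTA.norm_map_sq_le_of_lipschitzWith hLip (x (n + 1) - x n)
    rw [← neg_sub (x n) (x (n + 1)), inner_neg_right, real_inner_self_eq_norm_sq, sub_self,
      map_zero, norm_zero, neg_sub] at h
    rw [norm_sub_rev (x (n + 1)) (x n)] at h2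
    rw [hc_def]
    linarith
  have hmono : ∀ n, F (x (n + 1)) - F p ≤ F (x 1) - F p := by
    intro n
    induction n with
    | zero => exact le_rfl
    | succ n ih =>
      have := hdec (n + 1) (hdom n)
      have : 0 ≤ c * ‖x (n + 1) - x (n + 1 + 1)‖ ^ 2 := by positivity
      linarith
  have hgap0 : ∀ n, 0 ≤ F (x (n + 1)) - F p := fun n => sub_nonneg.2 (hpmin _ (hdom n))
  -- The starting point may lie outside the domain, so the sublevel set is the one of `x 1`.
  obtain ⟨κ, hκ, hgrow⟩ := ISTA.exists_quadratic_growth hω ha hb hp (hgap0 0)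
  choose z hz hzx using fun n => hgrow (x (n + 1)) (hdom n) (hmono n)
  set K := κ * l⁻¹ ^ 2 + L with hK_def
  have hK : 0 < K := by positivity
  -- Comparison with a minimizer close to `x (n + 1)`: the gap is at most quadratic in the step.
  have hup : ∀ n, F (x (n + 1)) - F p ≤ K * ‖x n - x (n + 1)‖ ^ 2 := by
    intro n
    obtain ⟨hzd, hzmin⟩ := (ISTA.isMinimizer_objective_iff hω ha hb A y _).1 (hz n)
    have h := hstep n _ hzd
    have h1 : F (z n) = F p := le_antisymm (hzmin p hpd) (hpmin _ hzd)
    have h2 := ISTA.norm_map_sq_le_of_lipschitzWith hLip (x (n + 1) - x n)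
    rw [norm_sub_rev (x (n + 1)) (x n)] at h2
    have h3 := real_inner_le_norm (x n - x (n + 1)) (x (n + 1) - z n)
    have h4 := mul_le_mul_of_nonneg_left h3 (inv_nonneg.2 hl_pos.le)
    have h5 := hzx n
    set s := ‖x n - x (n + 1)‖
    set t := ‖x (n + 1) - z n‖
    -- Young's inequality, balanced so that half of the gap is absorbed.
    have h6 : l⁻¹ * (s * t) ≤ 1 / 2 * (κ * l⁻¹ ^ 2 * s ^ 2) + 1 / 2 * (κ⁻¹ * t ^ 2) := by
      have h7 : 0 ≤ κ⁻¹ * (κ * l⁻¹ * s - t) ^ 2 := by positivity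
      have h8 : κ⁻¹ * (κ * l⁻¹ * s - t) ^ 2 =
          κ * l⁻¹ ^ 2 * s ^ 2 - 2 * (l⁻¹ * (s * t)) + κ⁻¹ * t ^ 2 := by
        field_simp
        ring
      linarith
    have h9 : κ⁻¹ * t ^ 2 ≤ F (x (n + 1)) - F p := by
      rwa [inv_mul_le_iff₀ hκ]
    have h10 := sq_nonneg ‖A (z n - x n)‖
    rw [h1] at h
    rw [hK_def]
    linarith
  set ε := K / (K + c) with hε
  have hε0 : 0 < ε := by positivity
  have hε1 : ε < 1 := (div_lt_one (by positivity)).2 (by linarith)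
  have hcontr : ∀ n, x n ∈ ISTA.l1Domain e a b →
      F (x (n + 1)) - F p ≤ ε * (F (x n) - F p) := fun n hn =>
    ISTA.gap_contraction hK hc (hdec n hn) (hup n)
  have hgeom : ∀ n, F (x (n + 1)) - F p ≤ ε ^ n * (F (x 1) - F p) := by
    intro n
    induction n with
    | zero => simp
    | succ n ih =>
      rw [pow_succ', mul_assoc]
      exact (hcontr (n + 1) (hdom n)).trans (mul_le_mul_of_nonneg_left ih hε0.le)
  have hsε0 : 0 < √ε := Real.sqrt_pos.2 hε0
  have hsε1 : √ε < 1 := by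
    rw [Real.sqrt_lt' one_pos, one_pow]; exact hε1
  set D := √((F (x 1) - F p) / c) with hD
  have hdist : ∀ n, dist (x (n + 1)) (x (n + 1 + 1)) ≤ D * √ε ^ n := by
    intro n
    have h1 := hdec (n + 1) (hdom n)
    have h2 : ‖x (n + 1) - x (n + 1 + 1)‖ ^ 2 ≤ (F (x 1) - F p) / c * ε ^ n := by
      rw [div_mul_eq_mul_div, le_div_iff₀' hc, mul_comm (F (x 1) - F p)]
      linarith [hgeom n, hgap0 (n + 1)]
    rw [dist_eq_norm]
    refine abs_le_of_sq_le_sq' ?_ (by positivity) |>.2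
    rwa [mul_pow, hD, Real.sq_sqrt (div_nonneg (hgap0 0) hc.le), ← pow_mul, mul_comm n,
      pow_mul, Real.sq_sqrt hε0.le]
  obtain ⟨xbar, hxbar⟩ := cauchySeq_tendsto_of_complete
    (cauchySeq_of_le_geometric (f := fun n => x (n + 1)) (√ε) D hsε1 hdist)
  refine ⟨xbar, ?_, (tendsto_add_atTop_iff_nat 1).1 hxbar, ε, hε0, hε1,
    -- The summand `1` keeps the constant positive when the iteration starts at its limit.
    D / (1 - √ε) + 1, ?_, fun n hn => ⟨?_, ?_⟩⟩
  · have hgap_lim : Tendsto (fun n => κ * (ε ^ n * (F (x 1) - F p))) atTop (𝓝 0) := by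
      have := ((tendsto_pow_atTop_nhds_zero_of_lt_one hε0.le hε1).mul_const
        (F (x 1) - F p)).const_mul κ
      simpa using this
    have hsq : Tendsto (fun n => ‖x (n + 1) - z n‖ ^ 2) atTop (𝓝 0) :=
      squeeze_zero (fun n => sq_nonneg _)
        (fun n => (hzx n).trans (mul_le_mul_of_nonneg_left (hgeom n) hκ.le)) hgap_lim
    have hnorm : Tendsto (fun n => ‖x (n + 1) - z n‖) atTop (𝓝 0) := by
      have := hsq.sqrt
      simpa [Real.sqrt_sq] using this
    have hzlim : Tendsto z atTop (𝓝 xbar) := by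
      have := hxbar.sub (tendsto_zero_iff_norm_tendsto_zero.2 hnorm)
      simpa using this
    exact (ISTA.isClosed_setOf_isMinimizer_objective hω ha hb hp).mem_of_tendsto hzlim
      (Eventually.of_forall hz)
  · have : 0 ≤ D / (1 - √ε) := div_nonneg (Real.sqrt_nonneg _) (by linarith)
    linarith
  · obtain ⟨m, rfl⟩ : ∃ m, n = m + 1 := ⟨n - 1, by omega⟩
    rw [hinf, ISTA.objective_of_mem hω ha hb A y (hdom m), ← EReal.coe_sub]
    by_cases h0 : x₀ ∈ ISTA.l1Domain e a b
    · rw [ISTA.objective_of_mem hω ha hb A y h0, ← EReal.coe_sub, ← EReal.coe_mul,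
        EReal.coe_le_coe_iff, pow_succ, mul_assoc]
      refine (hgeom m).trans (mul_le_mul_of_nonneg_left ?_ (by positivity))
      have := hcontr 0 (by rwa [hx0])
      rwa [hx0] at this
    · rw [ISTA.objective_of_notMem hω ha hb A y h0, EReal.top_sub_coe,
        EReal.coe_mul_top_of_pos (by positivity)]
      exact le_top
  · have h := dist_le_of_le_geometric_of_tendsto (√ε) D hsε1 hdist hxbar n
    rw [dist_eq_norm] at h
    refine h.trans ?_
    have : 0 ≤ √ε ^ n := by positivity
    rw [add_mul, one_mul, div_mul_eq_mul_div]
    linarith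

end
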